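/- A \emph{metric tree} is a tree $T=(V,E)$ together with a weight $w_e>0$ for each edge $e\in E$. Its vertex set $V$ carries the metric $d_T(x,y)=\sum_{e\in[x,y]}w_e$, where $[x,y]$ is the set of edges on the unique path from $x$ to $y$. If a root $x_0\in V$ is fixed, removing an edge $e$ separates $T$ into two half-trees, and $T_e\subset V$ denotes the set of vertices of the half-tree not containing $x_0$. Let $P_1(V)$ be the set of Borel probability measures $\mu$ on $(V,d_T)$ with finite first moment, i.e. $\int_V d_T(y,x)\,d\mu(x)<\infty$ for some (hence any) $y\in V$. For $\mu,\nu\in P_1(V)$ the Wasserstein distance is $$Wa(\mu,\nu)=\inf_\pi\int_{V\times V}d_T(x,y)\,d\pi(x,y),$$ the infimum being over all couplings $\pi$ of $\mu$ and $\nu$, i.e. all probability measures on $V\times V$ with marginals $\mu$ and $\nu$. \textbf{Theorem.} Let $T=(V,E)$ be a rooted metric tree with countably many vertices. Then for all $\mu,\nu\in P_1(V)$ the distance $Wa(\mu,\nu)$ is finite and $$Wa(\mu,\nu)=\sum_{e\in E}w_e\,|\mu(T_e)-\nu(T_e)|,$$ where the series on the right converges. -/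

import Mathlib

open MeasureTheory
open scoped ENNReal

universe u

/-! ### Measures of finite first moment and the Wasserstein distance -/

/-- The set `P₁(X)` of probability measures on the metric space `X` with finite first moment,
i.e. `∫ d(x₀, x) dμ(x) < ∞` for some base point `x₀`. -/
def P1 (X : Type u) [MetricSpace X] [MeasurableSpace X] : Set (Measure X) :=
  {μ | IsProbabilityMeasure μ ∧ ∃ x₀ : X, ∫⁻ x, edist x₀ x ∂μ < ∞}

/-- A coupling of `μ` and `ν`: a probability measure on `X × X` with marginals `μ` and `ν`. -/
def IsCoupling {X : Type u} [MeasurableSpace X] (π : Measure (X × X)) (μ ν : Measure X) : Prop :=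
  IsProbabilityMeasure π ∧ π.map Prod.fst = μ ∧ π.map Prod.snd = ν

/-- The Wasserstein distance: the infimum of the costs `∫ d(x, y) dπ(x, y)` over all couplings `π`
of `μ` and `ν`. It is defined with values in `[0, ∞]`, so that a divergent cost counts as `∞`. -/
noncomputable def Wa {X : Type u} [MetricSpace X] [MeasurableSpace X] (μ ν : Measure X) : ℝ≥0∞ :=
  ⨅ (π : Measure (X × X)) (_ : IsCoupling π μ ν), ∫⁻ p, edist p.1 p.2 ∂π

/-! ### Metric trees -/

/-- A metric tree: a tree `(V, E)` with a positive weight on each edge. -/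
structure MetricTree : Type (u + 1) where
  /-- the vertices -/
  V : Type u
  /-- the underlying graph, whose edge set is `E` -/
  graph : SimpleGraph V
  isTree : graph.IsTree
  /-- the weights `w_e` -/
  weight : graph.edgeSet → ℝ
  weight_pos : ∀ e, 0 < weight e

namespace MetricTree

variable (T : MetricTree.{u})

/-- The edges of `T`. -/
abbrev E : Type u := T.graph.edgeSet

/-- The unique path from `x` to `y`. -/
noncomputable def path (x y : T.V) : T.graph.Walk x y :=
  (T.isTree.existsUnique_path x y).choose

theorem path_isPath (x y : T.V) : (T.path x y).IsPath :=
  (T.isTree.existsUnique_path x y).choose_spec.1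

theorem eq_path {x y : T.V} {p : T.graph.Walk x y} (hp : p.IsPath) : p = T.path x y :=
  (T.isTree.existsUnique_path x y).choose_spec.2 p hp

open Classical in
/-- `[x, y]`, the set of edges on the unique path from `x` to `y`. -/
noncomputable def segment (x y : T.V) : Finset T.E :=
  (T.path x y).edges.toFinset.subtype (· ∈ T.graph.edgeSet)

theorem mem_segment {x y : T.V} {e : T.E} :
    e ∈ T.segment x y ↔ (e : Sym2 T.V) ∈ (T.path x y).edges := by
  simp [segment]

theorem segment_self (x : T.V) : T.segment x x = ∅ := by
  ext e
  rw [mem_segment, ← T.eq_path (SimpleGraph.Walk.IsPath.nil (u := x))]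
  simp

theorem segment_comm (x y : T.V) : T.segment x y = T.segment y x := by
  ext e
  rw [mem_segment, mem_segment, ← T.eq_path (T.path_isPath y x).reverse]
  simp

open Classical in
theorem segment_subset (x y z : T.V) : T.segment x z ⊆ T.segment x y ∪ T.segment y z := by
  intro e he
  rw [mem_segment,
    ← T.eq_path (SimpleGraph.Walk.bypass_isPath ((T.path x y).append (T.path y z)))] at he
  have h := SimpleGraph.Walk.edges_bypass_subset_edges _ he
  rw [SimpleGraph.Walk.edges_append, List.mem_append] at h
  simpa [mem_segment] using h

theorem eq_of_segment_eq_empty {x y : T.V} (h : T.segment x y = ∅) : x = y := by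
  have h' : (T.path x y).edges = [] := by
    rw [List.eq_nil_iff_forall_not_mem]
    intro e he
    have hm : (⟨e, SimpleGraph.Walk.edges_subset_edgeSet _ he⟩ : T.E) ∈ T.segment x y :=
      T.mem_segment.2 he
    simp [h] at hm
  generalize T.path x y = p at h'
  cases p with
  | nil => rfl
  | cons _ _ => simp at h'

/-- The metric space `(V, d_T)`, where `d_T(x, y) = ∑_{e ∈ [x, y]} w_e`. -/
noncomputable instance : MetricSpace T.V where
  dist x y := ∑ e ∈ T.segment x y, T.weight e
  dist_self x := by simp [segment_self]
  dist_comm x y := by rw [segment_comm]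
  dist_triangle x y z := by
    classical
    have hw : ∀ e, 0 ≤ T.weight e := fun e => (T.weight_pos e).le
    calc ∑ e ∈ T.segment x z, T.weight e
        ≤ ∑ e ∈ T.segment x y ∪ T.segment y z, T.weight e :=
          Finset.sum_le_sum_of_subset_of_nonneg (T.segment_subset x y z) fun e _ _ => hw e
      _ ≤ ∑ e ∈ T.segment x y, T.weight e + ∑ e ∈ T.segment y z, T.weight e := by
          rw [← Finset.sum_union_inter]
          exact le_add_of_nonneg_right (Finset.sum_nonneg fun e _ => hw e)
  eq_of_dist_eq_zero {x y} h := by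
    have h0 := (Finset.sum_eq_zero_iff_of_nonneg fun e _ => (T.weight_pos e).le).1 h
    refine T.eq_of_segment_eq_empty (Finset.eq_empty_of_forall_notMem fun e he => ?_)
    exact (T.weight_pos e).ne' (h0 e he)

/-- The vertex set carries the Borel `σ`-algebra of the metric `d_T`. -/
noncomputable instance : MeasurableSpace T.V := borel T.V

instance : BorelSpace T.V := ⟨rfl⟩

/-- `T_e`: removing the edge `e` separates the tree into two half-trees, and `T_e` is the set of
vertices of the one that does not contain the root `x₀`. -/
def below (x₀ : T.V) (e : T.E) : Set T.V :=
  {v | ¬ (T.graph.deleteEdges {(e : Sym2 T.V)}).Reachable x₀ v}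

end MetricTree

/-! ### Edges as cuts: segments, half-trees and the distance across an edge. -/

namespace MetricTree

variable (T : MetricTree.{u})

/-! An edge `e` lies on `[x, y]` exactly when `T_e` separates `x` from `y`. Hence a coupling `π`
costs `∑ w_e (U_e + D_e)`, where `U_e` and `D_e` are the masses it moves out of and into `T_e`. The
marginals force `U_e - D_e = μ(T_e) - ν(T_e)`, so the cost is the closed formula plus `2 ∑ w_e
min(U_e, D_e)` (`lintegral_edist_eq_add_tsum_min`). This gives the lower bound.

For the upper bound no optimal coupling is needed. Swapping the targets of mass that crosses `e` in
opposite directions saves at least `2 w_e U_e D_e` (`Wa_add_two_mul_le`), so along a minimizing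
sequence each `min(U_e, D_e)` tends to `0`. The excess series is dominated by `∑ w_e μ(T_e)`, the
first moment of `μ` about the root, and therefore tends to `0` as well. -/

theorem mem_segment_iff_not_reachable {x y : T.V} {e : T.E} :
    e ∈ T.segment x y ↔ ¬ (T.graph.deleteEdges {(e : Sym2 T.V)}).Reachable x y := by
  classical
  rw [mem_segment, iff_not_comm]
  constructor
  · rintro ⟨p⟩ he
    have hp := p.bypass_isPath
    have hq := (SimpleGraph.Walk.isPath_mapLe (T.graph.deleteEdges_le {(e : Sym2 T.V)})).2 hp
    rw [← T.eq_path hq, SimpleGraph.Walk.edges_mapLe_eq_edges] at he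
    have := SimpleGraph.Walk.edges_subset_edgeSet _ he
    simp [SimpleGraph.edgeSet_deleteEdges] at this
  · intro h
    exact ⟨(T.path x y).toDeleteEdge e h⟩

theorem mem_below_iff {x₀ x : T.V} {e : T.E} : x ∈ T.below x₀ e ↔ e ∈ T.segment x₀ x :=
  T.mem_segment_iff_not_reachable.symm

/-- A path repeats no edge, so cutting it at `e` leaves two paths that avoid `e` and share no edge.
-/
theorem segment_eq_of_mem {x y : T.V} {e : T.E} (he : e ∈ T.segment x y) :
    ∃ a b : T.V, (e : Sym2 T.V) = s(a, b) ∧ e ∉ T.segment x a ∧ e ∉ T.segment b y ∧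
      dist x y = dist x a + T.weight e + dist b y := by
  classical
  have key : ∀ {x y : T.V} (p : T.graph.Walk x y), p.IsPath → (e : Sym2 T.V) ∈ p.edges →
      ∃ (a b : T.V) (q : T.graph.Walk x a) (r : T.graph.Walk b y), (e : Sym2 T.V) = s(a, b) ∧
        q.IsPath ∧ r.IsPath ∧ p.edges = q.edges ++ s(a, b) :: r.edges := by
    intro x y p
    induction p with
    | nil => simp
    | @cons u v w h p ih =>
      intro hp hmem
      rw [SimpleGraph.Walk.edges_cons, List.mem_cons] at hmem
      rw [SimpleGraph.Walk.cons_isPath_iff] at hp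
      rcases hmem with hmem | hmem
      · exact ⟨u, v, .nil, p, hmem, .nil, hp.1, by simp⟩
      · obtain ⟨a, b, q, r, h1, h2, h3, h4⟩ := ih hp.1 hmem
        have hsub : (SimpleGraph.Walk.cons h q).IsPath := by
          rw [SimpleGraph.Walk.cons_isPath_iff]
          refine ⟨h2, fun hu => hp.2 ?_⟩
          by_cases hnil : q.Nil
          · have hvb : s(a, b) ∈ p.edges := by rw [h4]; simp
            have : u = v := by
              cases q with
              | nil => simpa using hu
              | cons _ _ => simp at hnil
            exact this ▸ p.start_mem_support
          · obtain ⟨f, hf, huf⟩ := (SimpleGraph.Walk.mem_support_iff_exists_mem_edges_of_not_nil hnil).1 hu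
            exact SimpleGraph.Walk.mem_support_of_mem_edges (e := f) (by rw [h4]; simp [hf]) huf
        exact ⟨a, b, .cons h q, r, h1, hsub, h3, by simp [h4]⟩
  obtain ⟨a, b, q, r, h1, h2, h3, h4⟩ := key (T.path x y) (T.path_isPath x y) (T.mem_segment.1 he)
  have hnd := (T.path_isPath x y).isTrail.edges_nodup
  rw [T.eq_path h2, T.eq_path h3, ← h1] at h4
  rw [h4, List.nodup_append] at hnd
  obtain ⟨hn1, hn2, hn3⟩ := hnd
  rw [List.nodup_cons] at hn2
  have hea : e ∉ T.segment x a := fun h => hn3 _ (T.mem_segment.1 h) _ (by simp) rfl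
  have heb : e ∉ T.segment b y := fun h => hn2.1 (T.mem_segment.1 h)
  have hdisj : Disjoint (T.segment x a) (T.segment b y) := by
    rw [Finset.disjoint_left]
    intro f hf hf'
    exact hn3 _ (T.mem_segment.1 hf) _ (List.mem_cons_of_mem _ (T.mem_segment.1 hf')) rfl
  have hseg : T.segment x y = T.segment x a ∪ insert e (T.segment b y) := by
    ext f
    simp only [mem_segment, h4, Finset.mem_union, Finset.mem_insert, List.mem_append,
      List.mem_cons, Subtype.ext_iff]
  refine ⟨a, b, h1, hea, heb, ?_⟩
  change ∑ f ∈ T.segment x y, T.weight f =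
    ∑ f ∈ T.segment x a, T.weight f + T.weight e + ∑ f ∈ T.segment b y, T.weight f
  rw [hseg, Finset.sum_union (by rw [Finset.disjoint_insert_right]; exact ⟨hea, hdisj⟩),
    Finset.sum_insert heb, add_assoc]

theorem mem_segment_iff_xor_mem_below (x₀ : T.V) {x y : T.V} {e : T.E} :
    e ∈ T.segment x y ↔ (x ∈ T.below x₀ e ∧ y ∉ T.below x₀ e) ∨
      (x ∉ T.below x₀ e ∧ y ∈ T.below x₀ e) := by
  by_cases hx : x ∈ T.below x₀ e <;> by_cases hy : y ∈ T.below x₀ e <;>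
    simp only [hx, hy, not_true, not_false_iff, and_true, and_false, or_false, or_true, iff_true,
      iff_false] <;> rw [mem_below_iff] at hx hy
  -- Both root paths cross `e`. If they cross in the same direction, its far end joins `x` to `y`;
  -- opposite directions would join the root to `x` without `e`.
  · obtain ⟨a, b, h1, h2, h3, -⟩ := T.segment_eq_of_mem hx
    obtain ⟨a', b', h1', h2', h3', -⟩ := T.segment_eq_of_mem hy
    rw [mem_segment_iff_not_reachable, not_not] at *
    rw [h1, Sym2.eq_iff] at h1'
    rcases h1' with ⟨rfl, rfl⟩ | ⟨rfl, rfl⟩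
    · exact h3.symm.trans h3'
    · exact absurd (h2'.trans h3) hx
  all_goals rw [mem_segment_iff_not_reachable] at *
  · exact fun h => hx ((not_not.1 hy).trans h.symm)
  · exact fun h => hy ((not_not.1 hx).trans h)
  · exact not_not.2 ((not_not.1 hx).symm.trans (not_not.1 hy))

/-- The end points of `e` cut the distance between points on either side of `e`. -/
theorem exists_dist_eq_of_mem_below (x₀ : T.V) (e : T.E) :
    ∃ p c : T.V, ∀ x y : T.V, x ∈ T.below x₀ e → y ∉ T.below x₀ e →
      dist x y = dist x c + T.weight e + dist p y := by
  by_cases hne : ∃ x y : T.V, x ∈ T.below x₀ e ∧ y ∉ T.below x₀ e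
  swap
  · exact ⟨x₀, x₀, fun x y hx hy => absurd ⟨x, y, hx, hy⟩ hne⟩
  have side : ∀ x y : T.V, x ∈ T.below x₀ e → y ∉ T.below x₀ e → ∃ c p : T.V,
      (e : Sym2 T.V) = s(c, p) ∧ c ∈ T.below x₀ e ∧ p ∉ T.below x₀ e ∧
      dist x y = dist x c + T.weight e + dist p y := by
    intro x y hx hy
    obtain ⟨a, b, h1, h2, h3, h4⟩ :=
      T.segment_eq_of_mem ((T.mem_segment_iff_xor_mem_below x₀ (e := e)).2 (.inl ⟨hx, hy⟩))
    rw [T.mem_segment_iff_xor_mem_below x₀] at h2 h3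
    exact ⟨a, b, h1, by tauto, by tauto, h4⟩
  -- Membership in `T_e` fixes which end of `e` is which, so one pair serves all `x` and `y`.
  obtain ⟨x, y, hx, hy⟩ := hne
  obtain ⟨c, p, h, hc, hp, -⟩ := side x y hx hy
  refine ⟨p, c, fun x' y' hx' hy' => ?_⟩
  obtain ⟨c', p', h', hc', hp', hd⟩ := side x' y' hx' hy'
  rw [h, Sym2.eq_iff] at h'
  rcases h' with ⟨rfl, rfl⟩ | ⟨rfl, rfl⟩
  · exact hd
  · exact absurd hc hp'

instance [Countable T.V] : Countable T.E := by
  unfold E; infer_instance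

open Classical in
theorem edist_eq_tsum (x₀ x y : T.V) :
    edist x y = ∑' e : T.E, ENNReal.ofReal (T.weight e) *
      (({p : T.V × T.V | p.1 ∈ T.below x₀ e ∧ p.2 ∉ T.below x₀ e}.indicator 1 (x, y) : ℝ≥0∞) +
        {p : T.V × T.V | p.1 ∉ T.below x₀ e ∧ p.2 ∈ T.below x₀ e}.indicator 1 (x, y)) := by
  rw [edist_dist]
  change ENNReal.ofReal (∑ e ∈ T.segment x y, T.weight e) = _
  rw [ENNReal.ofReal_sum_of_nonneg fun e _ => (T.weight_pos e).le, tsum_eq_sum (s := T.segment x y)]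
  · refine Finset.sum_congr rfl fun e he => ?_
    rw [T.mem_segment_iff_xor_mem_below x₀] at he
    rcases he with he | he <;> simp [Set.indicator, he]
  · intro e he
    rw [T.mem_segment_iff_xor_mem_below x₀] at he
    push Not at he
    by_cases h1 : x ∈ T.below x₀ e <;> by_cases h2 : y ∈ T.below x₀ e <;>
      simp_all [Set.indicator]

end MetricTree

/-! ### Improving a coupling by exchanging opposite flows. -/

section Swap

variable {X : Type u} [MetricSpace X] [MeasurableSpace X]

theorem Wa_le_lintegral {π : Measure (X × X)} {μ ν : Measure X} (h : IsCoupling π μ ν) :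
    Wa μ ν ≤ ∫⁻ p, edist p.1 p.2 ∂π :=
  iInf₂_le π h

variable [Countable X] [DiscreteMeasurableSpace X]

theorem lintegral_prod_fst_snd {X : Type u} [MeasurableSpace X] [Countable X]
    [DiscreteMeasurableSpace X] (α β : Measure (X × X)) [IsFiniteMeasure α] [IsFiniteMeasure β]
    (f g : X → ℝ≥0∞) :
    ∫⁻ p, f p.1 + g p.2 ∂(α.fst.prod β.snd) =
      β Set.univ * ∫⁻ p, f p.1 ∂α + α Set.univ * ∫⁻ p, g p.2 ∂β := by
  rw [lintegral_add_left .of_discrete, lintegral_prod _ .of_discrete, lintegral_prod _ .of_discrete]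
  simp only [lintegral_const, Measure.fst_univ, Measure.snd_univ]
  rw [lintegral_mul_const _ .of_discrete, mul_comm, mul_comm (α Set.univ), Measure.fst, Measure.snd,
    lintegral_map .of_discrete measurable_fst, lintegral_map .of_discrete measurable_snd]

/-- Exchanging the mass that crosses from `S` to its complement with the mass that crosses back
improves a coupling. -/
theorem Wa_add_two_mul_le {π : Measure (X × X)} {μ ν : Measure X} (h : IsCoupling π μ ν)
    (S : Set X) (p c : X) (w : ℝ≥0∞)
    (hd : ∀ x y, x ∈ S → y ∉ S → edist x y = edist x c + w + edist p y) :
    Wa μ ν + 2 * w * (π {q | q.1 ∈ S ∧ q.2 ∉ S} * π {q | q.1 ∉ S ∧ q.2 ∈ S}) ≤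
      ∫⁻ q, edist q.1 q.2 ∂π := by
  obtain ⟨hπ, h1, h2⟩ := h
  set A : Set (X × X) := {q | q.1 ∈ S ∧ q.2 ∉ S} with hA
  set B : Set (X × X) := {q | q.1 ∉ S ∧ q.2 ∈ S} with hB
  have hmeas : ∀ s : Set (X × X), MeasurableSet s := fun s => .of_discrete
  have hAB : Disjoint A B := Set.disjoint_left.2 fun q hq hq' => hq'.1 hq.1
  set α := π.restrict A with hα
  set β := π.restrict B with hβ
  set ρ := π.restrict (A ∪ B)ᶜ with hρ
  have hdec : π = ρ + (α + β) := by
    rw [hα, hβ, ← Measure.restrict_union hAB (hmeas _), hρ, Measure.restrict_compl_add_restrict (hmeas _)]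
  set U := π A with hU
  set D := π B with hD
  have hαU : α Set.univ = U := by simp [hα, hU]
  have hβD : β Set.univ = D := by simp [hβ, hD]
  have hU1 : (1 - U) + U = 1 := tsub_add_cancel_of_le prob_le_one
  have hD1 : (1 - D) + D = 1 := tsub_add_cancel_of_le prob_le_one
  have hsplit : ∀ {t : ℝ≥0∞}, (1 - t) + t = 1 → ∀ m : Measure X, m = (1 - t) • m + t • m :=
    fun ht m => by rw [← add_smul, ht, one_smul]
  -- The parts `D • α` and `U • β`, each of mass `U * D`, are re-paired by products, which have the
  -- same total marginals. The new pairs stay on one side of `S`, so they can be routed through `c`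
  -- or `p` without paying `w`.
  set π' := ρ + ((1 - D) • α + (1 - U) • β) + (α.fst.prod β.snd + β.fst.prod α.snd) with hπ'
  have hfst : π'.map Prod.fst = μ := by
    rw [← h1]
    conv_rhs => rw [hdec]
    simp only [hπ', Measure.map_add _ _ measurable_fst, Measure.map_smul, Measure.map_fst_prod,
      Measure.snd_univ, hαU, hβD]
    change _ = ρ.map Prod.fst + (α.fst + β.fst)
    change ρ.map Prod.fst + ((1 - D) • α.fst + (1 - U) • β.fst) + (D • α.fst + U • β.fst) = _
    conv_rhs => rw [hsplit hD1 α.fst, hsplit hU1 β.fst]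
    abel
  have hsnd : π'.map Prod.snd = ν := by
    rw [← h2]
    conv_rhs => rw [hdec]
    simp only [hπ', Measure.map_add _ _ measurable_snd, Measure.map_smul, Measure.map_snd_prod,
      Measure.fst_univ, hαU, hβD]
    change _ = ρ.map Prod.snd + (α.snd + β.snd)
    change ρ.map Prod.snd + ((1 - D) • α.snd + (1 - U) • β.snd) + (U • β.snd + D • α.snd) = _
    conv_rhs => rw [hsplit hD1 α.snd, hsplit hU1 β.snd]
    abel
  have hcoup : IsCoupling π' μ ν := by
    refine ⟨⟨?_⟩, hfst, hsnd⟩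
    have : μ Set.univ = 1 := by
      rw [← h1, Measure.map_apply measurable_fst .univ]; simp
    rw [← this, ← hfst, Measure.map_apply measurable_fst .univ]; simp
  have hcα : ∫⁻ q, edist q.1 q.2 ∂α =
      ∫⁻ q, edist q.1 c ∂α + w * U + ∫⁻ q, edist p q.2 ∂α := by
    rw [← hαU, ← lintegral_const, ← lintegral_add_left .of_discrete,
      ← lintegral_add_left .of_discrete]
    exact setLIntegral_congr_fun (hmeas _) fun q hq => hd _ _ hq.1 hq.2
  have hcβ : ∫⁻ q, edist q.1 q.2 ∂β =
      ∫⁻ q, edist c q.2 ∂β + w * D + ∫⁻ q, edist q.1 p ∂β := by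
    rw [← hβD, ← lintegral_const, ← lintegral_add_left .of_discrete,
      ← lintegral_add_left .of_discrete]
    refine setLIntegral_congr_fun (hmeas _) fun q hq => ?_
    rw [edist_comm, hd _ _ hq.2 hq.1, edist_comm c, edist_comm p]
  have hαβ : ∫⁻ q, edist q.1 q.2 ∂(α.fst.prod β.snd) ≤
      D * ∫⁻ q, edist q.1 c ∂α + U * ∫⁻ q, edist c q.2 ∂β := by
    rw [← hαU, ← hβD, ← lintegral_prod_fst_snd α β (edist · c) (edist c ·)]
    exact lintegral_mono fun q => edist_triangle _ _ _
  have hβα : ∫⁻ q, edist q.1 q.2 ∂(β.fst.prod α.snd) ≤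
      U * ∫⁻ q, edist q.1 p ∂β + D * ∫⁻ q, edist p q.2 ∂α := by
    rw [← hαU, ← hβD, ← lintegral_prod_fst_snd β α (edist · p) (edist p ·)]
    exact lintegral_mono fun q => edist_triangle _ _ _
  -- The coefficient `1` is kept as `(1 - D) + D`, so that `ring` can treat the truncated difference
  -- as an atom.
  have hcπ : ∫⁻ q, edist q.1 q.2 ∂π = ∫⁻ q, edist q.1 q.2 ∂ρ +
      (((1 - D) + D) * ∫⁻ q, edist q.1 q.2 ∂α + ((1 - U) + U) * ∫⁻ q, edist q.1 q.2 ∂β) := by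
    conv_lhs => rw [hdec]
    rw [lintegral_add_measure, lintegral_add_measure, hU1, hD1, one_mul, one_mul]
  calc Wa μ ν + 2 * w * (U * D)
      ≤ ∫⁻ q, edist q.1 q.2 ∂π' + 2 * w * (U * D) := by gcongr; exact Wa_le_lintegral hcoup
    _ ≤ ∫⁻ q, edist q.1 q.2 ∂ρ +
          ((1 - D) * ∫⁻ q, edist q.1 q.2 ∂α + (1 - U) * ∫⁻ q, edist q.1 q.2 ∂β) +
          ((D * ∫⁻ q, edist q.1 c ∂α + U * ∫⁻ q, edist c q.2 ∂β) +
          (U * ∫⁻ q, edist q.1 p ∂β + D * ∫⁻ q, edist p q.2 ∂α)) + 2 * w * (U * D) := by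
        simp only [hπ', lintegral_add_measure, lintegral_smul_measure, smul_eq_mul]
        gcongr
    _ = ∫⁻ q, edist q.1 q.2 ∂π := by
        rw [hcπ, add_mul, add_mul]
        nth_rw 3 [hcα]
        nth_rw 3 [hcβ]
        ring

end Swap

/-! ### Finiteness, and the arithmetic of opposite flows. -/

theorem isCoupling_prod {X : Type u} [MeasurableSpace X] (μ ν : Measure X)
    [IsProbabilityMeasure μ] [IsProbabilityMeasure ν] : IsCoupling (μ.prod ν) μ ν :=
  ⟨inferInstance, by simp, by simp⟩

theorem lintegral_edist_ne_top {X : Type u} [MetricSpace X] [MeasurableSpace X] {μ : Measure X}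
    (hμ : μ ∈ P1 X) (y : X) : ∫⁻ x, edist y x ∂μ ≠ ∞ := by
  obtain ⟨hprob, x₀, hx₀⟩ := hμ
  refine ((lintegral_mono fun x => edist_triangle y x₀ x).trans_lt ?_).ne
  rw [lintegral_add_left measurable_const]
  simpa [ENNReal.add_lt_top, edist_lt_top] using hx₀

theorem Wa_ne_top {X : Type u} [MetricSpace X] [MeasurableSpace X] [Countable X]
    [DiscreteMeasurableSpace X] {μ ν : Measure X} (hμ : μ ∈ P1 X) (hν : ν ∈ P1 X) (x₀ : X) :
    Wa μ ν ≠ ∞ := by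
  have := hμ.1
  have := hν.1
  refine ((Wa_le_lintegral (isCoupling_prod μ ν)).trans_lt ?_).ne
  refine (lintegral_mono fun q : X × X => edist_triangle_left q.1 q.2 x₀).trans_lt ?_
  rw [lintegral_add_left .of_discrete, lintegral_prod _ .of_discrete, lintegral_prod _ .of_discrete]
  simpa [ENNReal.add_lt_top, lt_top_iff_ne_top] using
    And.intro (lintegral_edist_ne_top hμ x₀) (lintegral_edist_ne_top hν x₀)

/-- This is `u + d = |u - d| + 2 min(u, d)`, scaled by `w`. -/
theorem ENNReal.ofReal_mul_abs_sub_add_two_mul_min {w a b : ℝ} {u d : ℝ≥0∞} (hw : 0 ≤ w)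
    (hu : u ≠ ∞) (hd : d ≠ ∞) (h : a - b = u.toReal - d.toReal) :
    ENNReal.ofReal w * (u + d) =
      ENNReal.ofReal (w * |a - b|) + 2 * (ENNReal.ofReal w * min u d) := by
  lift u to NNReal using hu
  lift d to NNReal using hd
  rw [h, ENNReal.ofReal_mul hw, mul_left_comm, ← mul_add]
  congr 1
  have hmin : 2 * min (u : ℝ≥0∞) d ≠ ∞ := by rw [← ENNReal.coe_min]; finiteness
  rw [← ENNReal.toReal_eq_toReal_iff' (by finiteness)
    (ENNReal.add_ne_top.2 ⟨ENNReal.ofReal_ne_top, hmin⟩), ENNReal.toReal_add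
    (by finiteness) (by finiteness), ENNReal.toReal_add ENNReal.ofReal_ne_top hmin,
    ENNReal.toReal_ofReal (abs_nonneg _), ENNReal.toReal_mul]
  simp only [ENNReal.coe_toReal, ← ENNReal.coe_min, NNReal.coe_min, ENNReal.toReal_ofNat]
  rcases le_total (u : ℝ) d with hle | hle
  · rw [abs_of_nonpos (by linarith), min_eq_left hle]; ring
  · rw [abs_of_nonneg (by linarith), min_eq_right hle]; ring

/-! ### The cost as a sum over edges, and the limit along a minimizing sequence. -/

namespace MetricTree

variable (T : MetricTree.{u}) [Countable T.V]

theorem lintegral_edist_eq_tsum (x₀ : T.V) (π : Measure (T.V × T.V)) :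
    ∫⁻ q, edist q.1 q.2 ∂π = ∑' e : T.E, ENNReal.ofReal (T.weight e) *
      (π {q | q.1 ∈ T.below x₀ e ∧ q.2 ∉ T.below x₀ e} +
        π {q | q.1 ∉ T.below x₀ e ∧ q.2 ∈ T.below x₀ e}) := by
  simp_rw [T.edist_eq_tsum x₀]
  rw [lintegral_tsum fun e => .of_discrete]
  refine tsum_congr fun e => ?_
  rw [lintegral_const_mul _ .of_discrete, lintegral_add_left .of_discrete]
  simp only [Prod.mk.eta]
  rw [lintegral_indicator_one .of_discrete, lintegral_indicator_one .of_discrete]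

/-- The root lies in no `T_e`, so only crossings into `T_e` count. This supplies the summable
majorant for dominated convergence. -/
theorem lintegral_edist_root_eq_tsum (x₀ : T.V) (μ : Measure T.V) :
    ∫⁻ x, edist x₀ x ∂μ = ∑' e : T.E, ENNReal.ofReal (T.weight e) * μ (T.below x₀ e) := by
  have hx₀ : ∀ e, x₀ ∉ T.below x₀ e := fun e he => he .rfl
  simp_rw [T.edist_eq_tsum x₀]
  rw [lintegral_tsum fun e => .of_discrete]
  refine tsum_congr fun e => ?_
  rw [lintegral_const_mul _ .of_discrete]
  congr 1
  rw [← lintegral_indicator_one (.of_discrete : MeasurableSet (T.below x₀ e))]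
  refine lintegral_congr fun x => ?_
  rw [Set.indicator_of_notMem (fun h => hx₀ e h.1), zero_add]
  by_cases hx : x ∈ T.below x₀ e
  · rw [Set.indicator_of_mem hx, Set.indicator_of_mem]
    exacts [rfl, ⟨hx₀ e, hx⟩]
  · rw [Set.indicator_of_notMem hx, Set.indicator_of_notMem fun h => hx h.2]

/-- The cost of a coupling exceeds the closed formula by the mass crossing edges both ways. -/
theorem lintegral_edist_eq_add_tsum_min (x₀ : T.V) {π : Measure (T.V × T.V)} {μ ν : Measure T.V}
    (h : IsCoupling π μ ν) :
    ∫⁻ q, edist q.1 q.2 ∂π =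
      ∑' e : T.E, ENNReal.ofReal
        (T.weight e * |μ.real (T.below x₀ e) - ν.real (T.below x₀ e)|) +
      2 * ∑' e : T.E, ENNReal.ofReal (T.weight e) *
        min (π {q | q.1 ∈ T.below x₀ e ∧ q.2 ∉ T.below x₀ e})
          (π {q | q.1 ∉ T.below x₀ e ∧ q.2 ∈ T.below x₀ e}) := by
  obtain ⟨hπ, h1, h2⟩ := h
  rw [T.lintegral_edist_eq_tsum x₀, ← ENNReal.tsum_mul_left, ← ENNReal.tsum_add]
  refine tsum_congr fun e => ?_
  refine ENNReal.ofReal_mul_abs_sub_add_two_mul_min (T.weight_pos e).le (measure_ne_top _ _)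
    (measure_ne_top _ _) ?_
  change _ = π.real _ - π.real _
  set S := T.below x₀ e
  -- The mass that stays inside `S` enters both marginals and cancels.
  have hμ : μ.real S = π.real {q | q.1 ∈ S ∧ q.2 ∉ S} + π.real (S ×ˢ S) := by
    rw [← h1, map_measureReal_apply measurable_fst .of_discrete,
      ← measureReal_union _ .of_discrete]
    · congr 1; ext q; by_cases hq : q.2 ∈ S <;> simp [hq]
    · exact Set.disjoint_left.2 fun q hq hq' => hq.2 hq'.2
  have hν : ν.real S = π.real {q | q.1 ∉ S ∧ q.2 ∈ S} + π.real (S ×ˢ S) := by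
    rw [← h2, map_measureReal_apply measurable_snd .of_discrete,
      ← measureReal_union _ .of_discrete]
    · congr 1; ext q; by_cases hq : q.1 ∈ S <;> simp [hq]
    · exact Set.disjoint_left.2 fun q hq hq' => hq.1 hq'.1
  rw [hμ, hν]; ring

theorem Wa_eq_tsum (x₀ : T.V) {μ ν : Measure T.V} (hμ : μ ∈ P1 T.V) (hν : ν ∈ P1 T.V) :
    Wa μ ν = ∑' e : T.E, ENNReal.ofReal
      (T.weight e * |μ.real (T.below x₀ e) - ν.real (T.below x₀ e)|) := by
  have hfin := Wa_ne_top hμ hν x₀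
  refine le_antisymm ?_ (le_iInf₂ fun π h => ?_)
  swap
  · rw [T.lintegral_edist_eq_add_tsum_min x₀ h]; exact le_self_add
  have hex : ∀ n : ℕ, ∃ π, IsCoupling π μ ν ∧
      ∫⁻ q, edist q.1 q.2 ∂π < Wa μ ν + ((n : ℝ≥0∞) + 1)⁻¹ := by
    intro n
    have hlt : Wa μ ν < Wa μ ν + ((n : ℝ≥0∞) + 1)⁻¹ :=
      ENNReal.lt_add_right hfin (ENNReal.inv_ne_zero.2 (by finiteness))
    conv_lhs at hlt => rw [Wa]
    simpa only [iInf_lt_iff, exists_prop] using hlt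
  choose π hπ hcost using hex
  set U : ℕ → T.E → ℝ≥0∞ := fun n e => π n {q | q.1 ∈ T.below x₀ e ∧ q.2 ∉ T.below x₀ e} with hU
  set D : ℕ → T.E → ℝ≥0∞ := fun n e => π n {q | q.1 ∉ T.below x₀ e ∧ q.2 ∈ T.below x₀ e} with hD
  have hsmall : ∀ n e, 2 * ENNReal.ofReal (T.weight e) * (U n e * D n e) ≤
      ((n : ℝ≥0∞) + 1)⁻¹ := by
    intro n e
    obtain ⟨p, c, hpc⟩ := T.exists_dist_eq_of_mem_below x₀ e
    have := Wa_add_two_mul_le (hπ n) (T.below x₀ e) p c (ENNReal.ofReal (T.weight e))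
      fun x y hx hy => by
        rw [edist_dist, hpc x y hx hy, edist_dist, edist_dist,
          ENNReal.ofReal_add (add_nonneg dist_nonneg (T.weight_pos e).le) dist_nonneg,
          ENNReal.ofReal_add dist_nonneg (T.weight_pos e).le]
    exact (ENNReal.add_le_add_iff_left hfin).1 (this.trans (hcost n).le)
  have hinv : Filter.Tendsto (fun n : ℕ => ((n : ℝ≥0∞) + 1)⁻¹) Filter.atTop (nhds 0) := by
    simpa using (Filter.tendsto_add_atTop_iff_nat 1).2 ENNReal.tendsto_inv_nat_nhds_zero
  have hmin : ∀ e, Filter.Tendsto (fun n => ENNReal.ofReal (T.weight e) * min (U n e) (D n e))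
      Filter.atTop (nhds 0) := by
    intro e
    have hw : ENNReal.ofReal (T.weight e) ≠ 0 := by simpa using T.weight_pos e
    -- The swap bounds only the product `U * D`, which dominates the square of the minimum.
    have hsq : Filter.Tendsto
        (fun n => (ENNReal.ofReal (T.weight e) * min (U n e) (D n e)) ^ 2)
        Filter.atTop (nhds 0) := by
      have hlim := ENNReal.Tendsto.const_mul (a := ENNReal.ofReal (T.weight e)) hinv
        (.inr ENNReal.ofReal_ne_top)
      rw [mul_zero] at hlim
      refine tendsto_of_tendsto_of_tendsto_of_le_of_le tendsto_const_nhds hlim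
        (fun _ => zero_le) fun n => ?_
      calc (ENNReal.ofReal (T.weight e) * min (U n e) (D n e)) ^ 2
          = ENNReal.ofReal (T.weight e) * (1 * ENNReal.ofReal (T.weight e) *
              (min (U n e) (D n e) * min (U n e) (D n e))) := by ring
        _ ≤ ENNReal.ofReal (T.weight e) * (2 * ENNReal.ofReal (T.weight e) *
              (U n e * D n e)) := by
            gcongr
            · exact one_le_two
            · exact min_le_left _ _
            · exact min_le_right _ _
        _ ≤ _ := by gcongr; exact hsmall n e
    have := hsq.ennrpow_const (1 / 2)
    have hroot : ∀ x : ℝ≥0∞, (x ^ 2) ^ (1 / 2 : ℝ) = x := fun x => by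
      rw [← ENNReal.rpow_natCast, ← ENNReal.rpow_mul]; norm_num
    simpa only [hroot, ENNReal.zero_rpow_of_pos (by norm_num : (0 : ℝ) < 1 / 2)] using this
  -- The series becomes an integral against counting measure, with every function on edges
  -- measurable.
  let _ : MeasurableSpace T.E := ⊤
  have htsum : Filter.Tendsto
      (fun n => ∑' e : T.E, ENNReal.ofReal (T.weight e) * min (U n e) (D n e))
      Filter.atTop (nhds 0) := by
    have := tendsto_lintegral_of_dominated_convergence (μ := Measure.count (α := T.E))
      (F := fun n e => ENNReal.ofReal (T.weight e) * min (U n e) (D n e)) (f := 0)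
      (fun e => ENNReal.ofReal (T.weight e) * μ (T.below x₀ e)) (fun n => measurable_from_top)
      (fun n => .of_forall fun e => ?_) ?_ (.of_forall hmin)
    · simpa only [lintegral_count, Pi.zero_apply, tsum_zero] using this
    · refine mul_le_mul_right ?_ _
      refine (min_le_left _ _).trans ?_
      rw [← (hπ n).2.1, Measure.map_apply measurable_fst .of_discrete]
      exact measure_mono fun q hq => hq.1
    · rw [lintegral_count, ← T.lintegral_edist_root_eq_tsum]
      exact lintegral_edist_ne_top hμ x₀
  have hlim := (ENNReal.Tendsto.const_mul (a := 2) htsum (.inr (by finiteness))).const_add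
    (∑' e : T.E, ENNReal.ofReal
      (T.weight e * |μ.real (T.below x₀ e) - ν.real (T.below x₀ e)|))
  rw [mul_zero, add_zero] at hlim
  refine ge_of_tendsto' hlim fun n => ?_
  rw [← T.lintegral_edist_eq_add_tsum_min x₀ (hπ n)]
  exact Wa_le_lintegral (hπ n)

end MetricTree

/-- The closed formula `Wa(μ, ν) = ∑_{e ∈ E} w_e |μ(T_e) − ν(T_e)|` on a rooted metric tree with
countably many vertices: the distance is finite and the series converges to it. -/
theorem theorem3 (T : MetricTree.{u}) [Countable T.V] (x₀ : T.V) (μ ν : Measure T.V)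
    (hμ : μ ∈ P1 T.V) (hν : ν ∈ P1 T.V) :
    Wa μ ν ≠ ∞ ∧
      HasSum (fun e : T.E => T.weight e * |μ.real (T.below x₀ e) - ν.real (T.below x₀ e)|)
        (Wa μ ν).toReal := by
  have hfin := Wa_ne_top hμ hν x₀
  refine ⟨hfin, ?_⟩
  rw [T.Wa_eq_tsum x₀ hμ hν] at hfin ⊢
  have h := ENNReal.hasSum_toReal hfin
  rw [← ENNReal.tsum_toReal_eq fun e => ENNReal.ofReal_ne_top] at h
  simpa only [ENNReal.toReal_ofReal (mul_nonneg (T.weight_pos _).le (abs_nonneg _))] using h
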